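/- A red/blue/purple colouring of the complete graph $K_n$ is a partition of its edge set into three (possibly empty) graphs $R, B, P$. For real $s,t>0$, let $g(n;s,t)$ denote the largest integer $g$ for which there is a red/blue/purple colouring of $K_n$ with $|P|=g$ such that $R\cup P$ contains no clique on $\lceil s\rceil$ vertices and $B\cup P$ contains no clique on $\lceil t\rceil$ vertices; it is defined whenever at least one such colouring exists. **Theorem.** Let $\ell\ge 1$ be an integer and let $0<c<\frac{1}{3\ell}$ be a real constant. Then $g(n;2\ell+1,cn)$ is defined for all sufficiently large $n$, and, as $n\to\infty$ with $\ell$ and $c$ fixed, $$g(n;2\ell+1,cn)\;\ge\;\left(\frac{\ell-1}{\ell}+c+o(1)\right)\frac{n^2}{2}.$$ -/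

import Mathlib

open Filter Topology

/-- A red/blue/purple colouring of the complete graph on `V`: a partition of its edges into
three graphs (colour classes may be empty). -/
structure RBPColouring (V : Type*) where
  red : SimpleGraph V
  blue : SimpleGraph V
  purple : SimpleGraph V
  disjoint_red_blue : Disjoint red blue
  disjoint_red_purple : Disjoint red purple
  disjoint_blue_purple : Disjoint blue purple
  cover : red ⊔ blue ⊔ purple = ⊤

/-- The colouring is `(s,t)`-free: the red/purple graph contains no `K_s` and the blue/purple graph
contains no `K_t`. -/
def RBPColouring.IsFree {V : Type*} (C : RBPColouring V) (s t : ℕ) : Prop :=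
  (C.purple ⊔ C.red).CliqueFree s ∧ (C.purple ⊔ C.blue).CliqueFree t

/-- The possible numbers of purple edges in an `(s,t)`-free red/blue/purple colouring of `K_n`,
where real parameters `s`, `t` are rounded up. -/
def purpleCounts (n : ℕ) (s t : ℝ) : Set ℕ :=
  {m | ∃ C : RBPColouring (Fin n), C.IsFree ⌈s⌉₊ ⌈t⌉₊ ∧ C.purple.edgeSet.ncard = m}

/-- `g(n;s,t)`: the largest number of purple edges in an `(s,t)`-free red/blue/purple colouring of
`K_n`. It is meaningful only when such a colouring exists; otherwise the value is `0`. -/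
noncomputable def purpleRamsey (n : ℕ) (s t : ℝ) : ℕ :=
  sSup (purpleCounts n s t)

/-! A fixed finite template is blown up to `n` vertices. Its vertices are pairs (part, cube point),
the parts forming `ℓ` cycles of length `2K`, with `e` about `cℓK`. Red joins far parts at nearly
antipodal cube points; purple joins opposite parts at intermediate Hamming distance; everything
else, including pairs inside a blown-up vertex, is blue.

A red/purple clique has at most two vertices over each cycle (`no_triangle_in_cycle`), hence at most
`2ℓ` in all. A blue/purple clique projects to a red-independent set. By concentration of measure,
two dense subsets of the cube contain nearly antipodal points (`exists_nearly_antipodal`), so the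
parts where such a set is dense are pairwise not far. They lie in one cycle and number at most `2e`
of `2Kℓ`, a density just below `c` (`card_le_of_red_independent`).

Almost all pairs of cube points are at intermediate distance, and each part is opposite to all other
cycles and to `2e - 1` points of its own. So purple has relative degree about `(ℓ-1)/ℓ + c`
(`card_templatePurple_ge`). -/

/-! ### Concentration of measure on the discrete cube. -/

/-- Poincaré inequality on the discrete cube for `1`-Lipschitz functions. -/
theorem cube_variance_le (N : ℕ) (f : (Fin N → Bool) → ℝ)
    (hf : ∀ x y, |f x - f y| ≤ hammingDist x y) :
    2 ^ N * ∑ x, f x ^ 2 - (∑ x, f x) ^ 2 ≤ N / 4 * 4 ^ N := by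
  induction N with
  | zero => simp
  | succ N ih =>
    have hsum : ∀ g : (Fin (N + 1) → Bool) → ℝ,
        ∑ x, g x = ∑ x, g (Fin.cons false x) + ∑ x, g (Fin.cons true x) := by
      intro g
      rw [← (Fin.consEquiv (fun _ : Fin (N + 1) => Bool)).sum_comp, Fintype.sum_prod_type,
        Fintype.sum_bool, add_comm]
      rfl
    have hcons : ∀ (a : Bool) (x y : Fin N → Bool),
        hammingDist (Fin.cons a x : Fin (N + 1) → Bool) (Fin.cons a y) = hammingDist x y := by
      intro a x y
      simp [hammingDist, Fin.card_filter_univ_succ]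
    have hflip : ∀ x : Fin N → Bool,
        hammingDist (Fin.cons false x : Fin (N + 1) → Bool) (Fin.cons true x) = 1 := by
      intro x
      simp [hammingDist, Fin.card_filter_univ_succ]
    have h0 := ih (fun x => f (Fin.cons false x)) fun x y => by
      simpa only [hcons] using hf (Fin.cons false x) (Fin.cons false y)
    have h1 := ih (fun x => f (Fin.cons true x)) fun x y => by
      simpa only [hcons] using hf (Fin.cons true x) (Fin.cons true y)
    have hdiff : |∑ x : Fin N → Bool, f (Fin.cons false x) - ∑ x, f (Fin.cons true x)| ≤ 2 ^ N := by
      rw [← Finset.sum_sub_distrib]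
      refine (Finset.abs_sum_le_sum_abs _ _).trans ?_
      refine (Finset.sum_le_card_nsmul _ _ 1 fun x _ => ?_).trans ?_
      · simpa only [hflip, Nat.cast_one] using hf (Fin.cons false x) (Fin.cons true x)
      · simp
    have hsq : (∑ x : Fin N → Bool, f (Fin.cons false x) - ∑ x, f (Fin.cons true x)) ^ 2
        ≤ 4 ^ N := by
      have : (4 : ℝ) ^ N = (2 ^ N) ^ 2 := by rw [← pow_mul, mul_comm, pow_mul]; norm_num
      rw [this]
      exact sq_le_sq' (by linarith [(abs_le.mp hdiff).1]) (abs_le.mp hdiff).2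
    rw [hsum f, hsum fun x => f x ^ 2]
    push_cast
    rw [pow_succ (2 : ℝ), pow_succ (4 : ℝ)]
    -- With `S₀, S₁` the sums over the two halves, the new left side is twice the sum of the old
    -- ones plus `(S₀ - S₁) ^ 2`.
    nlinarith

/-- Chebyshev's inequality on the discrete cube for `1`-Lipschitz functions. -/
theorem cube_chebyshev (N : ℕ) (f : (Fin N → Bool) → ℝ)
    (hf : ∀ x y, |f x - f y| ≤ hammingDist x y) (S : Finset (Fin N → Bool)) (t : ℝ) (ht : 0 ≤ t)
    (hS : ∀ x ∈ S, t ≤ |f x - (∑ y, f y) / 2 ^ N|) :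
    (S.card : ℝ) * t ^ 2 ≤ N / 4 * 2 ^ N := by
  set m := (∑ y, f y) / 2 ^ N with hm
  have hpos : (0 : ℝ) < 2 ^ N := by positivity
  have hm' : ∑ y, f y = m * 2 ^ N := by rw [hm]; field_simp
  have h1 : (S.card : ℝ) * t ^ 2 ≤ ∑ x, (f x - m) ^ 2 := by
    calc (S.card : ℝ) * t ^ 2 = ∑ x ∈ S, t ^ 2 := by simp
      _ ≤ ∑ x ∈ S, (f x - m) ^ 2 := Finset.sum_le_sum fun x hx => by
          rw [← sq_abs (f x - m)]; exact pow_le_pow_left₀ ht (hS x hx) 2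
      _ ≤ _ := Finset.sum_le_sum_of_subset_of_nonneg (Finset.subset_univ _)
          fun _ _ _ => sq_nonneg _
  have h2 : ∑ x, (f x - m) ^ 2 = ∑ x, f x ^ 2 - m ^ 2 * 2 ^ N := by
    have : ∀ x, (f x - m) ^ 2 = f x ^ 2 - 2 * m * f x + m ^ 2 := fun x => by ring
    simp only [this, Finset.sum_add_distrib, Finset.sum_sub_distrib, ← Finset.mul_sum, hm']
    simp
    ring
  have h3 := cube_variance_le N f hf
  rw [hm'] at h3
  have h4 : (4 : ℝ) ^ N = 2 ^ N * 2 ^ N := by rw [← mul_pow]; norm_num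
  rw [h4] at h3
  have h5 : 2 ^ N * (∑ x, f x ^ 2 - m ^ 2 * 2 ^ N) ≤ 2 ^ N * (N / 4 * 2 ^ N) := by
    nlinarith
  have h6 := le_of_mul_le_mul_left h5 hpos
  linarith

theorem hammingDist_not_right {N : ℕ} (x y : Fin N → Bool) :
    hammingDist x y + hammingDist x (fun i => !(y i)) = N := by
  have h : ∀ i, (x i ≠ !(y i)) ↔ ¬ (x i ≠ y i) := fun i => by
    cases x i <;> cases y i <;> simp
  unfold hammingDist
  simp only [h]
  rw [Finset.card_filter_add_card_filter_not]
  simp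

theorem sum_hammingDist (N : ℕ) (x : Fin N → Bool) :
    ∑ y, (hammingDist x y : ℝ) = N / 2 * 2 ^ N := by
  have hinv : Function.Involutive fun (y : Fin N → Bool) i => !(y i) := fun y => by simp
  have h1 : ∑ y, (hammingDist x y : ℝ) = ∑ y : Fin N → Bool, (hammingDist x (fun i => !(y i)) : ℝ) :=
    (Equiv.sum_comp hinv.toPerm fun y => (hammingDist x y : ℝ)).symm
  have h2 : ∑ y, (hammingDist x y : ℝ) + ∑ y : Fin N → Bool, (hammingDist x (fun i => !(y i)) : ℝ)
      = N * 2 ^ N := by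
    rw [← Finset.sum_add_distrib]
    have : ∀ y : Fin N → Bool,
        (hammingDist x y : ℝ) + (hammingDist x (fun i => !(y i)) : ℝ) = N := fun y => by
      exact_mod_cast hammingDist_not_right x y
    simp [this, mul_comm]
  linarith

theorem abs_hammingDist_sub_le {N : ℕ} (x y z : Fin N → Bool) :
    |(hammingDist x y : ℝ) - hammingDist x z| ≤ hammingDist y z := by
  have h1 : (hammingDist x y : ℝ) ≤ hammingDist x z + hammingDist z y := by
    exact_mod_cast hammingDist_triangle x z y
  have h2 : (hammingDist x z : ℝ) ≤ hammingDist x y + hammingDist y z := by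
    exact_mod_cast hammingDist_triangle x y z
  rw [hammingDist_comm z y] at h1
  rw [abs_le]
  constructor <;> linarith

/-- Most points of the cube are neither close to a given point nor close to its antipode. -/
theorem card_hammingDist_middle (r : ℕ) (hr : 0 < r) (x : Fin (8 * r) → Bool) :
    (1 - 1 / (2 * r : ℝ)) * 2 ^ (8 * r) ≤
      ((Finset.univ.filter fun y => 2 * r < hammingDist x y ∧ hammingDist x y < 7 * r).card : ℝ) := by
  have hr' : (0 : ℝ) < r := by exact_mod_cast hr
  set T := Finset.univ.filter fun y => 2 * r < hammingDist x y ∧ hammingDist x y < 7 * r with hT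
  -- The mean distance is `4r`, so both excluded ranges deviate from it by at least `2r`.
  have hc := cube_chebyshev (8 * r) (fun y => (hammingDist x y : ℝ))
    (fun y z => abs_hammingDist_sub_le x y z) Tᶜ (2 * r) (by positivity) ?_
  · have hadd : (T.card : ℝ) + (Tᶜ.card : ℝ) = 2 ^ (8 * r) := by
      have := Finset.card_add_card_compl T
      rw [Fintype.card_fun, Fintype.card_bool, Fintype.card_fin] at this
      exact_mod_cast this
    push_cast at hc
    have h2 : (Tᶜ.card : ℝ) ≤ 1 / (2 * r) * 2 ^ (8 * r) := by
      rw [div_mul_eq_mul_div, le_div_iff₀ (by positivity)]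
      have : (r : ℝ) * 2 * (Tᶜ.card * (2 * r)) ≤ r * 2 * (1 * 2 ^ (8 * r)) := by nlinarith
      exact le_of_mul_le_mul_left this (by positivity)
    linarith
  · intro y hy
    have hmean : (∑ y, (hammingDist x y : ℝ)) / 2 ^ (8 * r) = 4 * r := by
      rw [sum_hammingDist]; push_cast; field_simp; ring
    rw [hmean]
    simp only [hT, Finset.mem_compl, Finset.mem_filter, Finset.mem_univ, true_and, not_and_or,
      not_lt] at hy
    rcases hy with hy | hy
    · have : (hammingDist x y : ℝ) ≤ 2 * r := by exact_mod_cast hy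
      rw [abs_sub_comm]
      exact le_trans (by linarith) (le_abs_self _)
    · have : (7 * r : ℝ) ≤ hammingDist x y := by exact_mod_cast hy
      exact le_trans (by linarith) (le_abs_self _)

/-- Two dense subsets of the cube contain nearly antipodal points. -/
theorem exists_nearly_antipodal (r : ℕ) (ε : ℝ) (hε : 0 < ε) (hr : 8 < ε * r)
    (A B : Finset (Fin (8 * r) → Bool)) (hA : ε * 2 ^ (8 * r) ≤ A.card)
    (hB : ε * 2 ^ (8 * r) ≤ B.card) :
    ∃ a ∈ A, ∃ b ∈ B, 7 * r < hammingDist a b := by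
  by_contra! hcon
  have hr0 : (0 : ℝ) < r := by
    by_contra h
    nlinarith
  have hpow : (0 : ℝ) < 2 ^ (8 * r) := by positivity
  have hAne : A.Nonempty := by
    rw [← Finset.card_pos]
    have : (0 : ℝ) < A.card := lt_of_lt_of_le (by positivity) hA
    exact_mod_cast this
  -- `f` is the distance to `A`: it vanishes on `A` and, if the claim fails, is at least `r` on the
  -- antipodes of `B`.
  obtain ⟨f, hf⟩ : ∃ f : (Fin (8 * r) → Bool) → ℕ,
      ∀ x, f x = A.inf' hAne (fun a => hammingDist a x) := ⟨_, fun _ => rfl⟩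
  have hle : ∀ x y, f x ≤ f y + hammingDist y x := by
    intro x y
    obtain ⟨a, ha, hay⟩ := Finset.exists_mem_eq_inf' hAne (fun a => hammingDist a y)
    rw [hf x, hf y, hay]
    exact (Finset.inf'_le _ ha).trans (hammingDist_triangle a y x)
  have hlip : ∀ x y, |(f x : ℝ) - f y| ≤ hammingDist x y := by
    intro x y
    have h1 : (f x : ℝ) ≤ f y + hammingDist y x := by exact_mod_cast hle x y
    have h2 : (f y : ℝ) ≤ f x + hammingDist x y := by exact_mod_cast hle y x
    rw [hammingDist_comm y x] at h1
    rw [abs_le]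
    constructor <;> linarith
  have hfA : ∀ x ∈ A, f x = 0 := by
    intro x hx
    have := Finset.inf'_le (fun a => hammingDist a x) hx
    rw [hammingDist_self, ← hf x] at this
    omega
  have hinv : Function.Involutive fun (y : Fin (8 * r) → Bool) i => !(y i) := fun y => by simp
  set B' := B.map hinv.toPerm.toEmbedding with hB'
  have hfB : ∀ x ∈ B', r ≤ f x := by
    intro x hx
    obtain ⟨b, hb, rfl⟩ := Finset.mem_map.mp hx
    rw [hf, Finset.le_inf'_iff]
    intro a ha
    have h1 := hcon a ha b hb
    have h2 := hammingDist_not_right a b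
    change r ≤ hammingDist a (fun i => !(b i))
    omega
  have key : ∀ S : Finset (Fin (8 * r) → Bool), ε * 2 ^ (8 * r) ≤ S.card →
      ¬ ∀ x ∈ S, (r / 2 : ℝ) ≤ |(f x : ℝ) - (∑ y, (f y : ℝ)) / 2 ^ (8 * r)| := by
    intro S hS hall
    have h := cube_chebyshev (8 * r) (fun y => (f y : ℝ)) hlip S (r / 2) (by positivity) hall
    push_cast at h
    have h2 : ε * 2 ^ (8 * r) * (r / 2) ^ 2 ≤ 8 * r / 4 * 2 ^ (8 * r) :=
      (mul_le_mul_of_nonneg_right hS (by positivity)).trans h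
    have h3 : 2 ^ (8 * r) * r * (ε * r) ≤ 2 ^ (8 * r) * r * 8 := by nlinarith
    have h4 := le_of_mul_le_mul_left h3 (by positivity)
    linarith
  -- Wherever the mean of `f` lies, one of `A`, `B'` is entirely at distance at least `r / 2` from
  -- it.
  rcases le_total ((r : ℝ) / 2) ((∑ y, (f y : ℝ)) / 2 ^ (8 * r)) with h | h
  · refine key A hA fun x hx => ?_
    rw [hfA x hx, abs_sub_comm]
    exact le_trans (by simpa using h) (le_abs_self _)
  · refine key B' (by simpa [hB'] using hB) fun x hx => ?_
    have : (r : ℝ) ≤ f x := by exact_mod_cast hfB x hx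
    exact le_trans (by linarith) (le_abs_self _)

/-! ### Distances on a cycle. -/

/-- Two points of the cycle of length `2K` at cyclic distance at least `2e`. -/
def CycleFar (K e i j : ℕ) : Prop :=
  (i + 2 * e ≤ j ∧ j + 2 * e ≤ i + 2 * K) ∨ (j + 2 * e ≤ i ∧ i + 2 * e ≤ j + 2 * K)

/-- Two points of the cycle of length `2K` at distance less than `e` from being antipodal. -/
def CycleOpp (K e i j : ℕ) : Prop :=
  (i + K < j + e ∧ j < i + K + e) ∨ (j + K < i + e ∧ i < j + K + e)

theorem CycleFar.symm {K e i j : ℕ} (h : CycleFar K e i j) : CycleFar K e j i := Or.symm h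

theorem CycleOpp.symm {K e i j : ℕ} (h : CycleOpp K e i j) : CycleOpp K e j i := Or.symm h

theorem CycleOpp.far {K e i j : ℕ} (he : 3 * e ≤ K) (h : CycleOpp K e i j) :
    CycleFar K e i j := by
  unfold CycleOpp at h
  unfold CycleFar
  omega

/-- Both `i` and `k` are within less than `e` of the antipode of `j`. -/
theorem CycleOpp.not_far {K e i j k : ℕ} (hij : CycleOpp K e i j)
    (hjk : CycleOpp K e j k) : ¬ CycleFar K e i k := by
  unfold CycleOpp at hij hjk
  unfold CycleFar
  omega

/-- A set of points of the cycle that are pairwise at distance less than `2e` has at most `2e`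
points, as `2e` is at most a third of the length of the cycle. -/
theorem card_le_of_not_cycleFar {K e : ℕ} (he : 3 * e ≤ K) (he0 : 0 < e) (I : Finset ℕ)
    (hI : ∀ i ∈ I, i < 2 * K) (hfar : ∀ i ∈ I, ∀ j ∈ I, ¬ CycleFar K e i j) :
    I.card ≤ 2 * e := by
  rcases I.eq_empty_or_nonempty with rfl | ⟨o, ho⟩
  · simp
  have hoK := hI o ho
  -- `φ` is the signed displacement from `o`. Displacements are below `2e` in absolute value and `6e
  -- ≤ 2K`, so closeness on the cycle becomes closeness in `ℤ`, with no wrap-around.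
  obtain ⟨φ, hφ⟩ : ∃ φ : ℕ → ℤ, ∀ j, φ j =
      if (2 * K : ℤ) < j - o + 2 * e then (j : ℤ) - o - 2 * K
      else if (2 * K : ℤ) < o - j + 2 * e then (j : ℤ) - o + 2 * K else (j : ℤ) - o :=
    ⟨_, fun _ => rfl⟩
  have hclose : ∀ i ∈ I, ∀ j ∈ I, φ i < φ j + 2 * e ∧ (φ i = φ j → i = j) := by
    intro i hi j hj
    have h1 := hfar i hi j hj
    have h2 := hfar i hi o ho
    have h3 := hfar j hj o ho
    have h4 := hI i hi
    have h5 := hI j hj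
    unfold CycleFar at h1 h2 h3
    rw [hφ i, hφ j]
    split_ifs <;> omega
  have hne : (I.image φ).Nonempty := ⟨φ o, Finset.mem_image_of_mem _ ho⟩
  rw [← Finset.card_image_of_injOn (f := φ) fun i hi j hj h => (hclose i hi j hj).2 h]
  have hsub : I.image φ ⊆ Finset.Ico ((I.image φ).min' hne) ((I.image φ).min' hne + 2 * e) := by
    intro a ha
    rw [Finset.mem_Ico]
    refine ⟨Finset.min'_le _ _ ha, ?_⟩
    obtain ⟨j, hj, hj'⟩ := Finset.mem_image.mp (Finset.min'_mem _ hne)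
    obtain ⟨i, hi, rfl⟩ := Finset.mem_image.mp ha
    rw [← hj']
    exact (hclose i hi j hj).1
  refine (Finset.card_le_card hsub).trans ?_
  rw [Int.card_Ico]
  omega

open Classical in
theorem card_cycleOpp_ge {K e : ℕ} (he : 3 * e ≤ K) (i : Fin (2 * K)) :
    2 * e - 1 ≤ (Finset.univ.filter fun j : Fin (2 * K) => CycleOpp K e i j).card := by
  have hi := i.2
  have hmod : ∀ t, t < 2 * e - 1 → ∃ j : Fin (2 * K), CycleOpp K e i j ∧
      ((j : ℕ) = i + K + t + 1 - e ∨ (j : ℕ) + 2 * K = i + K + t + 1 - e) := by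
    intro t ht
    by_cases h : i + K + t + 1 - e < 2 * K
    · refine ⟨⟨_, h⟩, ?_, Or.inl rfl⟩
      unfold CycleOpp
      dsimp only
      omega
    · refine ⟨⟨i + K + t + 1 - e - 2 * K, by omega⟩, ?_, Or.inr ?_⟩
      · unfold CycleOpp
        dsimp only
        omega
      · dsimp only
        omega
  have : Nonempty (Fin (2 * K)) := ⟨i⟩
  choose! g hg using hmod
  have h := Finset.card_le_card_of_injOn (s := Finset.range (2 * e - 1))
    (t := Finset.univ.filter fun j : Fin (2 * K) => CycleOpp K e i j) g
    (fun t ht => by simpa using (hg t (by simpa using ht)).1) ?_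
  · simpa using h
  · intro s hs t ht hst
    have h1 := (hg s (by simpa using hs)).2
    have h2 := (hg t (by simpa using ht)).2
    rw [hst] at h1
    have h3 := (g t).2
    simp only [Finset.coe_range, Set.mem_Iio] at hs ht
    omega

/-! ### The template: cliques, red-independent sets and purple degrees. -/

/-- Points of the disjoint union of `ℓ` cycles in different cycles or far apart in one cycle. -/
def PartFar {ℓ K : ℕ} (e : ℕ) (p q : Fin ℓ × Fin (2 * K)) : Prop :=
  p.1 ≠ q.1 ∨ CycleFar K e p.2 q.2

/-- Points of the disjoint union of `ℓ` cycles in different cycles or nearly antipodal in one. -/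
def PartOpp {ℓ K : ℕ} (e : ℕ) (p q : Fin ℓ × Fin (2 * K)) : Prop :=
  p.1 ≠ q.1 ∨ CycleOpp K e p.2 q.2

/-- The vertices of the template: each point of the `ℓ` cycles carries a discrete cube. -/
abbrev TemplateVertex (ℓ K r : ℕ) : Type :=
  (Fin ℓ × Fin (2 * K)) × (Fin (8 * r) → Bool)

/-- The red graph of the template: far parts, nearly antipodal points of the cube. -/
def templateRed (ℓ K e r : ℕ) : SimpleGraph (TemplateVertex ℓ K r) where
  Adj u v := PartFar e u.1 v.1 ∧ 7 * r < hammingDist u.2 v.2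
  symm := ⟨fun _ _ h => ⟨h.1.imp Ne.symm CycleFar.symm, by simpa only [hammingDist_comm] using h.2⟩⟩
  loopless := ⟨fun _ h => by simp at h⟩

/-- The purple graph of the template: opposite parts, points of the cube neither close together nor
nearly antipodal. -/
def templatePurple (ℓ K e r : ℕ) : SimpleGraph (TemplateVertex ℓ K r) where
  Adj u v := PartOpp e u.1 v.1 ∧ 2 * r < hammingDist u.2 v.2 ∧ hammingDist u.2 v.2 < 7 * r
  symm := ⟨fun _ _ h => ⟨h.1.imp Ne.symm CycleOpp.symm, by simpa only [hammingDist_comm] using h.2⟩⟩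
  loopless := ⟨fun _ h => by simp at h⟩

theorem disjoint_templateRed_templatePurple (ℓ K e r : ℕ) :
    Disjoint (templateRed ℓ K e r) (templatePurple ℓ K e r) := by
  rw [disjoint_iff_inf_le]
  rintro u v ⟨h1, h2⟩
  exact absurd h1.2 (by have := h2.2.2; omega)

theorem adj_of_same_cycle {ℓ K e r : ℕ} (he : 3 * e ≤ K) {u v : TemplateVertex ℓ K r}
    (h : (templatePurple ℓ K e r ⊔ templateRed ℓ K e r).Adj u v) (huv : u.1.1 = v.1.1) :
    CycleFar K e u.1.2 v.1.2 ∧ 2 * r < hammingDist u.2 v.2 ∧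
      (CycleOpp K e u.1.2 v.1.2 ∨ 7 * r < hammingDist u.2 v.2) := by
  rcases h with ⟨h1, h2, -⟩ | ⟨h1, h2⟩
  · have h3 := h1.resolve_left (fun h => h huv)
    exact ⟨h3.far he, h2, Or.inl h3⟩
  · exact ⟨h1.resolve_left (fun h => h huv), by omega, Or.inr h2⟩

/-- Both `x` and `z` are within less than `r` of the antipode of `y`. -/
theorem hammingDist_lt_of_nearly_antipodal {r : ℕ} {x y z : Fin (8 * r) → Bool}
    (hxy : 7 * r < hammingDist x y) (hyz : 7 * r < hammingDist y z) :
    hammingDist x z < 2 * r := by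
  have h1 := hammingDist_not_right x y
  have h2 := hammingDist_not_right z y
  have h3 := hammingDist_triangle x (fun i => !(y i)) z
  rw [hammingDist_comm y z] at hyz
  rw [hammingDist_comm (fun i => !(y i)) z] at h3
  omega

/-- Each edge inside a cycle has opposite parts or nearly antipodal cube points, and two of the
three edges are of the same type. The third then has parts that are not far, or Hamming distance
below `2r`, which neither colour allows. -/
theorem no_triangle_in_cycle {ℓ K e r : ℕ} (he : 3 * e ≤ K) {u v w : TemplateVertex ℓ K r}
    (huv : (templatePurple ℓ K e r ⊔ templateRed ℓ K e r).Adj u v)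
    (hvw : (templatePurple ℓ K e r ⊔ templateRed ℓ K e r).Adj v w)
    (huw : (templatePurple ℓ K e r ⊔ templateRed ℓ K e r).Adj u w)
    (h1 : u.1.1 = v.1.1) (h2 : v.1.1 = w.1.1) : False := by
  obtain ⟨f1, g1, o1⟩ := adj_of_same_cycle he huv h1
  obtain ⟨f2, g2, o2⟩ := adj_of_same_cycle he hvw h2
  obtain ⟨f3, g3, o3⟩ := adj_of_same_cycle he huw (h1.trans h2)
  have g1' := hammingDist_comm u.2 v.2
  have g2' := hammingDist_comm v.2 w.2
  rcases o1 with o1 | o1 <;> rcases o2 with o2 | o2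
  · exact o1.not_far o2 f3
  · rcases o3 with o3 | o3
    · exact o1.symm.not_far o3 f2
    · have := hammingDist_lt_of_nearly_antipodal o3 (g2' ▸ o2)
      omega
  · rcases o3 with o3 | o3
    · exact o3.not_far o2.symm f1
    · have := hammingDist_lt_of_nearly_antipodal (g1' ▸ o1) o3
      omega
  · have := hammingDist_lt_of_nearly_antipodal o1 o2
    omega

theorem template_cliqueFree {ℓ K e r : ℕ} (he : 3 * e ≤ K) :
    (templatePurple ℓ K e r ⊔ templateRed ℓ K e r).CliqueFree (2 * ℓ + 1) := by
  intro S hS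
  obtain ⟨k, -, hk⟩ := Finset.exists_lt_card_fiber_of_mul_lt_card_of_maps_to
    (s := S) (t := (Finset.univ : Finset (Fin ℓ))) (f := fun u => u.1.1) (n := 2)
    (fun _ _ => Finset.mem_univ _) (by rw [hS.card_eq, Finset.card_univ, Fintype.card_fin]; omega)
  obtain ⟨u, v, w, hu, hv, hw, huv, huw, hvw⟩ := Finset.two_lt_card_iff.mp hk
  rw [Finset.mem_filter] at hu hv hw
  exact no_triangle_in_cycle he (hS.isClique hu.1 hv.1 huv) (hS.isClique hv.1 hw.1 hvw)
    (hS.isClique hu.1 hw.1 huw) (hu.2.trans hv.2.symm) (hv.2.trans hw.2.symm)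

theorem card_le_of_not_partFar {ℓ K e : ℕ} (he : 3 * e ≤ K) (he0 : 0 < e)
    (I : Finset (Fin ℓ × Fin (2 * K))) (hI : ∀ p ∈ I, ∀ q ∈ I, ¬ PartFar e p q) :
    I.card ≤ 2 * e := by
  have hinj : Set.InjOn (fun p : Fin ℓ × Fin (2 * K) => (p.2 : ℕ)) I := by
    intro p hp q hq hpq
    have h := hI p hp q hq
    unfold PartFar at h
    push Not at h
    exact Prod.ext h.1 (Fin.ext hpq)
  rw [← Finset.card_image_of_injOn hinj]
  refine card_le_of_not_cycleFar he he0 _ ?_ ?_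
  · simp only [Finset.mem_image]
    rintro _ ⟨p, -, rfl⟩
    exact p.2.2
  · simp only [Finset.mem_image]
    rintro _ ⟨p, hp, rfl⟩ _ ⟨q, hq, rfl⟩ h
    exact hI p hp q hq (Or.inr h)

theorem card_le_of_red_independent {ℓ K e r : ℕ} (he : 3 * e ≤ K) (he0 : 0 < e) {ε : ℝ}
    (hε : 0 < ε) (hr : 8 < ε * r) (T : Finset (TemplateVertex ℓ K r))
    (hT : ∀ u ∈ T, ∀ v ∈ T, ¬ (templateRed ℓ K e r).Adj u v) :
    (T.card : ℝ) ≤ (2 * e + ε * (2 * K * ℓ)) * 2 ^ (8 * r) := by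
  classical
  let F : Fin ℓ × Fin (2 * K) → Finset (Fin (8 * r) → Bool) := fun p =>
    Finset.univ.filter fun x => (p, x) ∈ T
  -- `I` collects the parts with a dense fibre; the sparse fibres together contribute only the `ε`
  -- term.
  let I := Finset.univ.filter fun p => ε * 2 ^ (8 * r) ≤ ((F p).card : ℝ)
  have hI : I.card ≤ 2 * e := by
    refine card_le_of_not_partFar he he0 I fun p hp q hq hpq => ?_
    obtain ⟨a, ha, b, hb, hab⟩ := exists_nearly_antipodal r ε hε hr (F p) (F q)
      (Finset.mem_filter.mp hp).2 (Finset.mem_filter.mp hq).2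
    exact hT (p, a) (Finset.mem_filter.mp ha).2 (q, b) (Finset.mem_filter.mp hb).2 ⟨hpq, hab⟩
  have hcard : T.card = ∑ p, (F p).card := by
    rw [Finset.card_eq_sum_card_fiberwise (f := Prod.fst) (t := Finset.univ) (by simp)]
    refine Finset.sum_congr rfl fun p _ => ?_
    refine (Finset.card_bij (fun x _ => (p, x)) ?_ ?_ ?_).symm
    · intro x hx
      simpa [F] using hx
    · intro x _ y _ h
      exact (Prod.ext_iff.mp h).2
    · rintro ⟨q, x⟩ h
      obtain ⟨h1, rfl⟩ := Finset.mem_filter.mp h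
      exact ⟨x, by simpa [F] using h1, rfl⟩
  have hle : ∀ p, ((F p).card : ℝ) ≤ (if p ∈ I then 2 ^ (8 * r) else 0) + ε * 2 ^ (8 * r) := by
    intro p
    split_ifs with hp
    · have h1 : (F p).card ≤ 2 ^ (8 * r) := (Finset.card_le_univ _).trans (by simp)
      have h2 : ((F p).card : ℝ) ≤ 2 ^ (8 * r) := by exact_mod_cast h1
      have : 0 ≤ ε * 2 ^ (8 * r) := by positivity
      linarith
    · have : ¬ ε * 2 ^ (8 * r) ≤ ((F p).card : ℝ) := fun h => hp (by simpa [I] using h)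
      linarith
  have hIr : (I.card : ℝ) ≤ 2 * e := by exact_mod_cast hI
  calc (T.card : ℝ) = ∑ p, ((F p).card : ℝ) := by rw [hcard]; push_cast; rfl
    _ ≤ ∑ p, ((if p ∈ I then 2 ^ (8 * r) else 0) + ε * 2 ^ (8 * r)) :=
        Finset.sum_le_sum fun p _ => hle p
    _ = I.card * 2 ^ (8 * r) + ε * (2 * K * ℓ) * 2 ^ (8 * r) := by
        rw [Finset.sum_add_distrib, Finset.sum_ite_mem, Finset.univ_inter]
        simp
        ring
    _ ≤ 2 * e * 2 ^ (8 * r) + ε * (2 * K * ℓ) * 2 ^ (8 * r) := by gcongr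
    _ = _ := by ring

open Classical in
theorem card_partOpp_ge {ℓ K e : ℕ} (he : 3 * e ≤ K) (p : Fin ℓ × Fin (2 * K)) :
    (ℓ - 1) * (2 * K) + (2 * e - 1) ≤ (Finset.univ.filter fun q => PartOpp e p q).card := by
  have hsub : (Finset.univ.erase p.1 ×ˢ (Finset.univ : Finset (Fin (2 * K)))) ∪
      ({p.1} ×ˢ Finset.univ.filter fun j : Fin (2 * K) => CycleOpp K e p.2 j) ⊆
      Finset.univ.filter fun q => PartOpp e p q := by
    intro q hq
    simp only [Finset.mem_union, Finset.mem_product, Finset.mem_erase, Finset.mem_univ,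
      Finset.mem_singleton, Finset.mem_filter, true_and, and_true] at hq ⊢
    exact hq.imp Ne.symm And.right
  refine le_trans ?_ (Finset.card_le_card hsub)
  rw [Finset.card_union_of_disjoint]
  · rw [Finset.card_product, Finset.card_product, Finset.card_erase_of_mem (Finset.mem_univ _)]
    have := card_cycleOpp_ge he p.2
    simpa using this
  · rw [Finset.disjoint_left]
    intro q h1 h2
    simp only [Finset.mem_product, Finset.mem_erase, Finset.mem_singleton] at h1 h2
    exact h1.1.1 h2.1

open Classical in
theorem card_templatePurple_ge {ℓ K e r : ℕ} (he : 3 * e ≤ K) (he0 : 0 < e) (hℓ : 1 ≤ ℓ)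
    (hr : 0 < r) (u : TemplateVertex ℓ K r) :
    ((ℓ - 1) * (2 * K) + (2 * e - 1)) * ((1 - 1 / (2 * r : ℝ)) * 2 ^ (8 * r)) ≤
      ((Finset.univ.filter fun v => (templatePurple ℓ K e r).Adj u v).card : ℝ) := by
  have hprod : (Finset.univ.filter fun v => (templatePurple ℓ K e r).Adj u v) =
      (Finset.univ.filter fun q => PartOpp e u.1 q) ×ˢ
      (Finset.univ.filter fun y => 2 * r < hammingDist u.2 y ∧ hammingDist u.2 y < 7 * r) := by
    ext v
    rw [Finset.mem_product, Finset.mem_filter, Finset.mem_filter, Finset.mem_filter]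
    simp only [Finset.mem_univ, true_and]
    rfl
  rw [hprod, Finset.card_product, Nat.cast_mul]
  have h1 : ((ℓ - 1) * (2 * K) + (2 * e - 1) : ℝ) ≤
      ((Finset.univ.filter fun q => PartOpp e u.1 q).card : ℝ) := by
    have := (Nat.cast_le (α := ℝ)).mpr (card_partOpp_ge he u.1)
    rw [Nat.cast_add, Nat.cast_mul, Nat.cast_sub hℓ, Nat.cast_sub (by omega)] at this
    push_cast at this
    exact this
  have hr1 : (1 : ℝ) ≤ r := by exact_mod_cast hr
  have h2 : (1 : ℝ) / (2 * r) ≤ 1 := by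
    rw [div_le_one (by positivity)]
    linarith
  exact mul_le_mul h1 (card_hammingDist_middle r hr u.2)
    (mul_nonneg (by linarith) (by positivity)) (by positivity)

/-! ### Balanced blow-ups. -/

theorem card_fin_mod_eq (n m a : ℕ) (ha : a < m) :
    n / m ≤ (Finset.univ.filter fun v : Fin n => (v : ℕ) % m = a).card ∧
      (Finset.univ.filter fun v : Fin n => (v : ℕ) % m = a).card ≤ n / m + 1 := by
  have h : (Finset.univ.filter fun v : Fin n => (v : ℕ) % m = a).card =
      n.count (· ≡ a [MOD m]) := by
    rw [Nat.count_eq_card_filter_range, ← Finset.card_map Fin.valEmbedding]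
    congr 1
    ext v
    simp only [Finset.mem_map, Finset.mem_filter, Finset.mem_univ, true_and,
      Fin.valEmbedding_apply, Finset.mem_range, Nat.ModEq, Nat.mod_eq_of_lt ha]
    exact ⟨by rintro ⟨w, hw, rfl⟩; exact ⟨w.2, hw⟩, fun ⟨h1, h2⟩ => ⟨⟨v, h1⟩, h2, rfl⟩⟩
  rw [h, Nat.count_modEq_card _ (by omega)]
  split_ifs <;> omega

/-- A map from `Fin n` to a finite nonempty type whose fibres have nearly equal sizes. -/
theorem exists_balanced_map (V : Type*) [Fintype V] [DecidableEq V] [Nonempty V] (n : ℕ) :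
    ∃ f : Fin n → V, ∀ a,
      (n : ℝ) / Fintype.card V - 1 ≤ ((Finset.univ.filter fun v => f v = a).card : ℝ) ∧
      ((Finset.univ.filter fun v => f v = a).card : ℝ) ≤ (n : ℝ) / Fintype.card V + 1 := by
  have hm : 0 < Fintype.card V := Fintype.card_pos
  have hm' : (0 : ℝ) < Fintype.card V := by exact_mod_cast hm
  let g := Fintype.equivFin V
  refine ⟨fun v => g.symm ⟨v % Fintype.card V, Nat.mod_lt _ hm⟩, fun a => ?_⟩
  have h := card_fin_mod_eq n (Fintype.card V) (g a) (g a).2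
  have heq : (Finset.univ.filter fun v : Fin n =>
      g.symm ⟨v % Fintype.card V, Nat.mod_lt _ hm⟩ = a) =
      Finset.univ.filter fun v : Fin n => (v : ℕ) % Fintype.card V = g a := by
    refine Finset.filter_congr fun v _ => ?_
    rw [Equiv.symm_apply_eq, Fin.ext_iff]
  rw [heq]
  have h1 : ((n / Fintype.card V : ℕ) : ℝ) ≤ (n : ℝ) / Fintype.card V := Nat.cast_div_le
  have h2 : (n : ℝ) / Fintype.card V < ((n / Fintype.card V : ℕ) : ℝ) + 1 := by
    rw [div_lt_iff₀ hm']
    have := Nat.lt_div_mul_add (a := n) hm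
    have h3 : n < (n / Fintype.card V + 1) * Fintype.card V := by linarith
    exact_mod_cast h3
  have h4 := (Nat.cast_le (α := ℝ)).mpr h.1
  have h5 := (Nat.cast_le (α := ℝ)).mpr h.2
  push_cast at h5
  constructor <;> linarith

/-- The colouring of the complete graph on `W` pulled back along `f : W → V` from disjoint red and
purple graphs on `V`; all other pairs are blue. -/
def RBPColouring.pullback {V W : Type*} (R P : SimpleGraph V) (h : Disjoint R P) (f : W → V) :
    RBPColouring W where
  red := R.comap f
  purple := P.comap f
  blue := (R.comap f ⊔ P.comap f)ᶜ
  disjoint_red_blue := disjoint_compl_right.mono_left le_sup_left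
  disjoint_red_purple := by
    rw [disjoint_iff_inf_le] at h ⊢
    intro u v huv
    exact h (v := f u) (w := f v) huv
  disjoint_blue_purple := disjoint_compl_left.mono_right le_sup_right
  cover := by
    rw [sup_right_comm]
    exact sup_compl_eq_top

-- Fibres are blue, so a red/purple clique maps injectively to a clique of `P ⊔ R`, while a
-- blue/purple clique maps to a red-independent set with each fibre contributing at most its size.
open Classical in
theorem exists_blowup {V : Type*} [Fintype V] [Nonempty V] (R P : SimpleGraph V)
    (hRP : Disjoint R P) (s : ℕ) (hfree : (P ⊔ R).CliqueFree s) (α β : ℝ)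
    (hα : ∀ T : Finset V, (∀ u ∈ T, ∀ v ∈ T, ¬ R.Adj u v) → (T.card : ℝ) ≤ α)
    (hβ0 : 0 ≤ β)
    (hβ : ∀ u, β ≤ ((Finset.univ.filter fun v => P.Adj u v).card : ℝ)) (n : ℕ) :
    ∃ C : RBPColouring (Fin n), (C.purple ⊔ C.red).CliqueFree s ∧
      (∀ S : Finset (Fin n), (C.purple ⊔ C.blue).IsClique S →
        (S.card : ℝ) ≤ α * ((n : ℝ) / Fintype.card V + 1)) ∧
      n * (((n : ℝ) / Fintype.card V - 1) * β) ≤ 2 * (C.purple.edgeSet.ncard : ℝ) := by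
  obtain ⟨f, hf⟩ := exists_balanced_map V n
  refine ⟨RBPColouring.pullback R P hRP f, ?_, ?_, ?_⟩
  · intro S hS
    have hadj : ∀ u ∈ S, ∀ v ∈ S, u ≠ v → (P ⊔ R).Adj (f u) (f v) := fun u hu v hv huv =>
      hS.isClique hu hv huv
    refine hfree (S.image f) ⟨?_, ?_⟩
    · intro a ha b hb hab
      obtain ⟨u, hu, rfl⟩ := Finset.mem_image.mp ha
      obtain ⟨v, hv, rfl⟩ := Finset.mem_image.mp hb
      exact hadj u hu v hv fun h => hab (h ▸ rfl)
    · rw [Finset.card_image_of_injOn, hS.card_eq]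
      intro u hu v hv huv
      by_contra hne
      exact (hadj u hu v hv hne).ne huv
  · intro S hS
    have hind : ∀ a ∈ S.image f, ∀ b ∈ S.image f, ¬ R.Adj a b := by
      intro a ha b hb hab
      obtain ⟨u, hu, rfl⟩ := Finset.mem_image.mp ha
      obtain ⟨v, hv, rfl⟩ := Finset.mem_image.mp hb
      have hne : u ≠ v := fun h => hab.ne (h ▸ rfl)
      rcases hS hu hv hne with h | h
      · exact disjoint_iff_inf_le.mp hRP ⟨hab, h⟩
      · exact h.2 (Or.inl hab)
    have hcard : (S.card : ℝ) ≤ (S.image f).card * ((n : ℝ) / Fintype.card V + 1) := by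
      rw [Finset.card_eq_sum_card_image f S]
      push_cast
      rw [← nsmul_eq_mul]
      refine Finset.sum_le_card_nsmul _ _ _ fun a _ => le_trans ?_ (hf a).2
      exact_mod_cast Finset.card_le_card (Finset.filter_subset_filter _ (Finset.subset_univ S))
    exact hcard.trans (mul_le_mul_of_nonneg_right (hα _ hind) (by positivity))
  · change _ ≤ 2 * ((P.comap f).edgeSet.ncard : ℝ)
    have h1 : 2 * ((P.comap f).edgeSet.ncard : ℝ) = ∑ u, ((P.comap f).degree u : ℝ) := by
      rw [← SimpleGraph.coe_edgeFinset, Set.ncard_coe_finset]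
      exact_mod_cast ((P.comap f).sum_degrees_eq_twice_card_edges).symm
    rw [h1]
    have h2 : ∀ u : Fin n, ((n : ℝ) / Fintype.card V - 1) * β ≤ ((P.comap f).degree u : ℝ) := by
      intro u
      have h3 : ((P.comap f).degree u : ℝ) = ∑ a ∈ Finset.univ.filter (fun a => P.Adj (f u) a),
          ((Finset.univ.filter fun v => f v = a).card : ℝ) := by
        rw [← SimpleGraph.card_neighborFinset_eq_degree, SimpleGraph.neighborFinset_eq_filter,
          Finset.card_eq_sum_card_fiberwise (f := f)
            (t := Finset.univ.filter (fun a => P.Adj (f u) a)) (fun v hv => by simpa using hv)]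
        push_cast
        refine Finset.sum_congr rfl fun a ha => ?_
        rw [Finset.filter_filter]
        congr 2
        ext v
        simp only [Finset.mem_filter, Finset.mem_univ, true_and] at ha ⊢
        exact ⟨fun h => h.2, fun h => ⟨by rw [← h] at ha; exact ha, h⟩⟩
      rw [h3]
      -- If `n` is less than the number of template vertices, the lower bound on fibre sizes is
      -- negative and the claim is trivial.
      rcases le_total 0 ((n : ℝ) / Fintype.card V - 1) with hq | hq
      · calc ((n : ℝ) / Fintype.card V - 1) * β
            ≤ ((n : ℝ) / Fintype.card V - 1) *
              (Finset.univ.filter fun v => P.Adj (f u) v).card :=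
              mul_le_mul_of_nonneg_left (hβ (f u)) hq
          _ ≤ _ := by
              rw [mul_comm, ← nsmul_eq_mul]
              exact Finset.card_nsmul_le_sum _ _ _ fun a _ => (hf a).1
      · exact (mul_nonpos_of_nonpos_of_nonneg hq hβ0).trans
          (Finset.sum_nonneg fun _ _ => Nat.cast_nonneg _)
    have h4 := Finset.card_nsmul_le_sum Finset.univ (fun u => ((P.comap f).degree u : ℝ)) _
      fun u _ => h2 u
    simpa using h4

/-! ### Choice of parameters and the asymptotic bound. -/

open Classical in
theorem exists_template (ℓ : ℕ) (hℓ : 1 ≤ ℓ) (c : ℝ) (hc0 : 0 < c) (hc : c < 1 / (3 * (ℓ : ℝ)))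
    (δ : ℝ) (hδ : 0 < δ) :
    ∃ (V : Type) (_ : Fintype V) (_ : Nonempty V) (R P : SimpleGraph V) (a b : ℝ),
      Disjoint R P ∧ (P ⊔ R).CliqueFree (2 * ℓ + 1) ∧ a < c ∧ 0 ≤ b ∧
      ((ℓ : ℝ) - 1) / ℓ + c - δ ≤ b ∧
      (∀ T : Finset V, (∀ u ∈ T, ∀ v ∈ T, ¬ R.Adj u v) → (T.card : ℝ) ≤ a * Fintype.card V) ∧
      ∀ u, b * Fintype.card V ≤ ((Finset.univ.filter fun v => P.Adj u v).card : ℝ) := by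
  have hℓ1 : (1 : ℝ) ≤ ℓ := by exact_mod_cast hℓ
  have hℓ0 : (0 : ℝ) < ℓ := by linarith
  have hcℓ : 3 * (c * ℓ) < 1 := by
    rw [lt_div_iff₀ (by positivity)] at hc
    linarith
  obtain ⟨η, hη0, hηc, hηδ⟩ : ∃ η : ℝ, 0 < η ∧ η < c ∧ η ≤ δ / 2 :=
    ⟨min (c / 2) (δ / 2), by positivity, lt_of_le_of_lt (min_le_left _ _) (by linarith),
      min_le_right _ _⟩
  have hθ0 : 0 < (c - η) * ℓ := mul_pos (by linarith) hℓ0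
  -- The bounds on `K` give `e ≥ 1` and rounding loss at most `δ / 4`; those on `r` give the
  -- hypothesis `8 < (η / 2) * r` and cube loss `1 / (2r) ≤ δ / 8`, which counts at most twice. With
  -- `η ≤ δ / 2` the total loss is at most `δ`.
  obtain ⟨K, hK⟩ := exists_nat_gt (max (1 / ((c - η) * ℓ)) (6 / δ))
  obtain ⟨r, hr⟩ := exists_nat_gt (max (16 / η) (4 / δ))
  obtain ⟨hK1, hK2⟩ := max_lt_iff.mp hK
  obtain ⟨hr1, hr2⟩ := max_lt_iff.mp hr
  have hK0 : (0 : ℝ) < K := lt_trans (by positivity) hK1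
  have hr0 : (0 : ℝ) < r := lt_trans (by positivity) hr1
  rw [div_lt_iff₀ (by positivity)] at hK1 hK2 hr1 hr2
  set e := ⌊(c - η) * ℓ * K⌋₊ with he
  have he1 : (e : ℝ) ≤ (c - η) * ℓ * K := Nat.floor_le (by positivity)
  have he2 : (c - η) * ℓ * K < e + 1 := Nat.lt_floor_add_one _
  have he0 : 0 < e := Nat.floor_pos.mpr (by linarith)
  have he0' : (1 : ℝ) ≤ e := by exact_mod_cast he0
  have heK : 3 * e ≤ K := by
    have h1 : (c - η) * ℓ * K ≤ c * ℓ * K := by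
      gcongr
      linarith
    have : (3 * e : ℝ) ≤ K := by nlinarith
    exact_mod_cast this
  have hKn : 0 < K := by exact_mod_cast hK0
  have hrn : 0 < r := by exact_mod_cast hr0
  have hcard : (Fintype.card (TemplateVertex ℓ K r) : ℝ) = 2 * K * ℓ * 2 ^ (8 * r) := by
    simp
    ring
  have hne : Nonempty (TemplateVertex ℓ K r) :=
    ⟨((⟨0, hℓ⟩, ⟨0, by omega⟩), fun _ => false)⟩
  have hr1' : (1 : ℝ) ≤ r := by exact_mod_cast hrn
  have hinv : (1 : ℝ) / (2 * r) ≤ 1 := by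
    rw [div_le_one (by positivity)]
    linarith
  -- Density `c - η / 2` is `c - η` from the dense parts plus `η / 2` from the sparse ones; the gap
  -- below `c` later absorbs the uneven fibre sizes.
  refine ⟨TemplateVertex ℓ K r, inferInstance, hne, templateRed ℓ K e r, templatePurple ℓ K e r,
    c - η / 2, (((ℓ - 1) * (2 * K) + (2 * e - 1)) * (1 - 1 / (2 * r : ℝ))) / (2 * K * ℓ),
    disjoint_templateRed_templatePurple ℓ K e r, template_cliqueFree heK, by linarith, ?_, ?_, ?_, ?_⟩
  · refine div_nonneg (mul_nonneg (add_nonneg (mul_nonneg ?_ ?_) ?_) ?_) (by positivity)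
    · linarith
    · positivity
    · linarith
    · linarith
  · have hd1 : ((ℓ : ℝ) - 1) / ℓ + (c - η) - 3 / (2 * K * ℓ) ≤
        ((ℓ - 1) * (2 * K) + (2 * e - 1)) / (2 * K * ℓ) := by
      have : ((ℓ : ℝ) - 1) / ℓ + (c - η) - 3 / (2 * K * ℓ) =
          ((ℓ - 1) * (2 * K) + (2 * ((c - η) * ℓ * K) - 3)) / (2 * K * ℓ) := by
        field_simp
        ring
      rw [this]
      exact div_le_div_of_nonneg_right (by linarith) (by positivity)
    have hd2 : (3 : ℝ) / (2 * K * ℓ) ≤ δ / 4 := by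
      rw [div_le_iff₀ (by positivity)]
      nlinarith
    have hd3 : ((ℓ - 1) * (2 * K) + (2 * e - 1)) / (2 * K * ℓ) ≤ (2 : ℝ) := by
      rw [div_le_iff₀ (by positivity)]
      have : (3 * e : ℝ) ≤ K := by exact_mod_cast heK
      nlinarith
    have hd4 : (1 : ℝ) / (2 * r) ≤ δ / 8 := by
      rw [div_le_iff₀ (by positivity)]
      nlinarith
    rw [mul_div_right_comm]
    have hd5 : (0 : ℝ) ≤ 1 / (2 * r) := by positivity
    nlinarith [mul_le_mul_of_nonneg_right hd3 hd5]
  · intro T hT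
    have h := card_le_of_red_independent heK he0 (ε := η / 2) (by positivity) (by linarith) T hT
    refine h.trans ?_
    rw [hcard, ← mul_assoc (c - η / 2)]
    refine mul_le_mul_of_nonneg_right ?_ (by positivity)
    linarith
  · intro u
    refine le_trans (le_of_eq ?_) (card_templatePurple_ge heK he0 hℓ hrn u)
    rw [hcard]
    field_simp

theorem eventually_exists_purpleCounts (ℓ : ℕ) (hℓ : 1 ≤ ℓ) (c : ℝ) (hc0 : 0 < c)
    (hc : c < 1 / (3 * (ℓ : ℝ))) (δ : ℝ) (hδ : 0 < δ) :
    ∀ᶠ n : ℕ in atTop, ∃ m ∈ purpleCounts n (2 * (ℓ : ℝ) + 1) (c * (n : ℝ)),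
      (((ℓ : ℝ) - 1) / ℓ + c - δ) * ((n : ℝ) ^ 2 / 2) ≤ m := by
  classical
  obtain ⟨V, _, _, R, P, a, b, hRP, hfree, hac, hb0, hb, hα, hβ⟩ :=
    exists_template ℓ hℓ c hc0 hc (δ / 2) (by positivity)
  have hm : (0 : ℝ) < Fintype.card V := by exact_mod_cast Fintype.card_pos
  set m : ℝ := (Fintype.card V : ℝ) with hmdef
  have hceil : ⌈2 * (ℓ : ℝ) + 1⌉₊ = 2 * ℓ + 1 := by
    have : (2 * (ℓ : ℝ) + 1) = ((2 * ℓ + 1 : ℕ) : ℝ) := by push_cast; ring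
    rw [this, Nat.ceil_natCast]
  have hev : Tendsto (fun n : ℕ => (n : ℝ)) atTop atTop := tendsto_natCast_atTop_atTop
  -- The first threshold gives `a * n + a * m < c * n`; the second makes the rounding loss `m * b *
  -- n` at most `δ / 2 * n ^ 2`.
  filter_upwards [hev.eventually_gt_atTop (a * m / (c - a)),
    hev.eventually_ge_atTop (2 * m * b / δ)] with n hn1 hn2
  rw [div_lt_iff₀ (by linarith)] at hn1
  rw [div_le_iff₀ hδ] at hn2
  obtain ⟨C, hC1, hC2, hC3⟩ := exists_blowup R P hRP _ hfree (a * m) (b * m) hα (by positivity) hβ n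
  refine ⟨C.purple.edgeSet.ncard, ⟨C, ⟨hceil ▸ hC1, fun S hS => ?_⟩, rfl⟩, ?_⟩
  · have h1 := hC2 S hS.isClique
    have h2 : c * n ≤ S.card := by
      rw [hS.card_eq]
      exact Nat.le_ceil _
    have h3 : a * m * ((n : ℝ) / m + 1) = a * n + a * m := by field_simp
    rw [← hmdef, h3] at h1
    nlinarith
  · rw [← hmdef] at hC3
    have h3 : n * (((n : ℝ) / m - 1) * (b * m)) = b * n ^ 2 - m * b * n := by field_simp
    rw [h3] at hC3
    have hn0 : (0 : ℝ) ≤ n := Nat.cast_nonneg n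
    have h4 := mul_le_mul_of_nonneg_right hb (sq_nonneg (n : ℝ))
    have h5 := mul_le_mul_of_nonneg_right hn2 hn0
    nlinarith

theorem bddAbove_purpleCounts (n : ℕ) (s t : ℝ) : BddAbove (purpleCounts n s t) := by
  refine ⟨Nat.card (Sym2 (Fin n)), ?_⟩
  rintro m ⟨C, -, rfl⟩
  exact Set.ncard_le_card _

theorem theorem5p1 (ℓ : ℕ) (hℓ : 1 ≤ ℓ) (c : ℝ) (hc0 : 0 < c) (hc : c < 1 / (3 * (ℓ : ℝ))) :
    ∃ ε : ℕ → ℝ, Tendsto ε atTop (𝓝 0) ∧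
      ∀ᶠ n : ℕ in atTop,
        IsGreatest (purpleCounts n (2 * (ℓ : ℝ) + 1) (c * (n : ℝ)))
          (purpleRamsey n (2 * (ℓ : ℝ) + 1) (c * (n : ℝ))) ∧
        (((ℓ : ℝ) - 1) / (ℓ : ℝ) + c + ε n) * ((n : ℝ) ^ 2 / 2) ≤
          (purpleRamsey n (2 * (ℓ : ℝ) + 1) (c * (n : ℝ)) : ℝ) := by
  set g : ℕ → ℝ := fun n => (purpleRamsey n (2 * (ℓ : ℝ) + 1) (c * (n : ℝ)) : ℝ) with hg
  set L : ℝ := ((ℓ : ℝ) - 1) / (ℓ : ℝ) + c with hL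
  have hlow : ∀ δ : ℝ, 0 < δ → ∀ᶠ n : ℕ in atTop, (L - δ) * ((n : ℝ) ^ 2 / 2) ≤ g n := by
    intro δ hδ
    filter_upwards [eventually_exists_purpleCounts ℓ hℓ c hc0 hc δ hδ] with n ⟨m, hm, hle⟩
    refine hle.trans ?_
    exact Nat.cast_le.mpr (le_csSup (bddAbove_purpleCounts n _ _) hm)
  -- Only a lower bound is available, so any excess of the normalised `g` over `L` is cut off to
  -- make the error tend to `0`.
  refine ⟨fun n => min 0 (g n / ((n : ℝ) ^ 2 / 2) - L), ?_, ?_⟩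
  · rw [Metric.tendsto_nhds]
    intro δ hδ
    filter_upwards [hlow (δ / 2) (by positivity), eventually_gt_atTop 0] with n hn hn0
    have hpos : (0 : ℝ) < (n : ℝ) ^ 2 / 2 := by positivity
    have h1 : L - δ / 2 ≤ g n / ((n : ℝ) ^ 2 / 2) := by rwa [le_div_iff₀ hpos]
    rw [Real.dist_eq, sub_zero, abs_of_nonpos (min_le_left _ _), neg_lt, lt_min_iff]
    constructor <;> linarith
  · filter_upwards [eventually_exists_purpleCounts ℓ hℓ c hc0 hc 1 one_pos,
      eventually_gt_atTop 0] with n ⟨m, hm, _⟩ hn0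
    refine ⟨⟨Nat.sSup_mem ⟨m, hm⟩ (bddAbove_purpleCounts n _ _),
      fun k hk => le_csSup (bddAbove_purpleCounts n _ _) hk⟩, ?_⟩
    have hpos : (0 : ℝ) < (n : ℝ) ^ 2 / 2 := by positivity
    have h1 : L + min 0 (g n / ((n : ℝ) ^ 2 / 2) - L) ≤ g n / ((n : ℝ) ^ 2 / 2) := by
      linarith [min_le_right 0 (g n / ((n : ℝ) ^ 2 / 2) - L)]
    rwa [le_div_iff₀ hpos] at h1
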